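/- Let $(M,g)$ be a smooth $3$-dimensional Riemannian manifold with Levi-Civita connection $\nabla$, Ricci tensor $S$ and scalar curvature $r$. Let $(\phi,\xi,\eta,g)$ be a trans-Sasakian structure of type $(\alpha,\beta)$ on $M$. That is, $\phi$ is a smooth $(1,1)$-tensor field, $\xi$ a smooth vector field and $\eta$ a smooth $1$-form with $$\phi^2=-I+\eta\otimes\xi,\quad \eta(\xi)=1,\quad \eta(X)=g(X,\xi),\quad g(\phi X,\phi Y)=g(X,Y)-\eta(X)\eta(Y),\quad g(X,\phi Y)+g(Y,\phi X)=0,$$ and $\alpha,\beta$ are smooth functions on $M$ such that, for all vector fields $X,Y$, $$(\nabla_X\phi)Y=\alpha\,[g(X,Y)\xi-\eta(Y)X]+\beta\,[g(\phi X,Y)\xi-\eta(Y)\phi X].$$ Let $\lambda,\mu$ be real constants such that $(g,\xi,\lambda,\mu)$ is an $\eta$-Einstein soliton, i.e. $$\mathcal L_\xi g+2S+(2\lambda-r)g+2\mu\,\eta\otimes\eta=0.$$ Assume that the Ricci tensor is cyclic parallel, i.e. $S$ is not identically zero and, for all vector fields $X,Y,Z$, $$(\nabla_XS)(Y,Z)+(\nabla_YS)(Z,X)+(\nabla_ZS)(X,Y)=0.$$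 Assume moreover that $\mu\neq\beta$, in the sense that $\beta$ is not identically equal to the constant $\mu$ on any connected component of $M$ (for connected $M$: $\beta\not\equiv\mu$). Then $\beta=0$ everywhere on $M$, so the structure is $\alpha$-Sasakian, i.e. trans-Sasakian of type $(\alpha,0)$. Furthermore $\lambda=\alpha^2$ at every point of $M$; in particular, if $\alpha$ is not identically zero, then the soliton is expanding, i.e. $\lambda>0$. -/

import Mathlib

open Bundle VectorField FiberBundle
open scoped Manifold ContDiff

namespace RiemannianGeometry
noncomputable section

variable {E : Type*} [NormedAddCommGroup E] [NormedSpace ℝ E]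
  {H : Type*} [TopologicalSpace H] (I : ModelWithCorners ℝ E H)
  {M : Type*} [TopologicalSpace M] [ChartedSpace H M]
  [RiemannianBundle (fun x : M ↦ TangentSpace I x)]

/-- Half of the right-hand side of Koszul's formula for `2 g(∇_X Y, Z)`, at the point `x`. -/
def koszul (Y X Z : Π x : M, TangentSpace I x) (x : M) : ℝ :=
  (d% (fun y ↦ inner ℝ (Y y) (Z y)) x (X x) + d% (fun y ↦ inner ℝ (Z y) (X y)) x (Y x)
    - d% (fun y ↦ inner ℝ (X y) (Y y)) x (Z x)
    - inner ℝ (X x) (mlieBracket I Y Z x) + inner ℝ (Y x) (mlieBracket I Z X x)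
    + inner ℝ (Z x) (mlieBracket I X Y x)) / 2

/-- The Lie derivative of the metric,
`(L_V g)(X, Y) = V (g(X, Y)) - g([V, X], Y) - g(X, [V, Y])`, at the point `x`. -/
def lieDerivMetric (V X Y : Π x : M, TangentSpace I x) (x : M) : ℝ :=
  d% (fun y ↦ inner ℝ (X y) (Y y)) x (V x)
    - inner ℝ (mlieBracket I V X x) (Y x) - inner ℝ (X x) (mlieBracket I V Y x)

variable [IsManifold I ∞ M]

/-- `X` is a vector field that is smooth (of class `C^∞`) at the point `x`. -/
def SmoothFieldAt (X : Π x : M, TangentSpace I x) (x : M) : Prop :=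
  ContMDiffAt I I.tangent ∞ (fun y ↦ (⟨y, X y⟩ : TangentBundle I M)) x

variable (M) in
/-- An almost contact metric structure `(φ, ξ, η, g)` on `M`, where `g` is the Riemannian metric
that `M` carries. -/
structure AlmostContactMetricStructure where
  /-- The `(1, 1)`-tensor field. -/
  phi : Π x : M, TangentSpace I x →L[ℝ] TangentSpace I x
  /-- The characteristic vector field. -/
  xi : Π x : M, TangentSpace I x
  /-- The contact form. -/
  eta : Π x : M, TangentSpace I x →L[ℝ] ℝ
  smooth_phi : ContMDiff I (I.prod 𝓘(ℝ, E →L[ℝ] E)) ∞ (fun x ↦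
    TotalSpace.mk' (E →L[ℝ] E) (E := fun x : M ↦ TangentSpace I x →L[ℝ] TangentSpace I x) x (phi x))
  smooth_xi : ∀ x, SmoothFieldAt I xi x
  smooth_eta : ContMDiff I (I.prod 𝓘(ℝ, E →L[ℝ] ℝ)) ∞ (fun x ↦
    TotalSpace.mk' (E →L[ℝ] ℝ) (E := fun x : M ↦ TangentSpace I x →L[ℝ] ℝ) x (eta x))
  phi_phi : ∀ x (v : TangentSpace I x), phi x (phi x v) = -v + eta x v • xi x
  eta_xi : ∀ x, eta x (xi x) = 1
  eta_eq_inner : ∀ x (v : TangentSpace I x), eta x v = inner ℝ v (xi x)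
  inner_phi_phi : ∀ x (v w : TangentSpace I x),
    inner ℝ (phi x v) (phi x w) = inner ℝ v w - eta x v * eta x w
  inner_phi_skew : ∀ x (v w : TangentSpace I x),
    (inner ℝ v (phi x w) : ℝ) + inner ℝ w (phi x v) = 0

theorem eq_of_inner_extend {x : M} {u w : TangentSpace I x}
    (h : ∀ Z : Π x : M, TangentSpace I x, MDiffAt (T% Z) x →
      (inner ℝ u (Z x) : ℝ) = inner ℝ w (Z x)) : u = w := by
  refine ext_inner_right ℝ fun v ↦ ?_
  simpa using h (extend E v) (mdifferentiableAt_extend ..)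

variable [IsContMDiffRiemannianBundle I ∞ E (fun x : M ↦ TangentSpace I x)]

theorem mdifferentiableAt_metric {X Y : Π x : M, TangentSpace I x} {x : M}
    (hX : MDiffAt (T% X) x) (hY : MDiffAt (T% Y) x) :
    MDiffAt (fun y ↦ inner ℝ (X y) (Y y)) x :=
  MDifferentiableAt.inner_bundle (IB := I) (F := E) (E := fun x : M ↦ TangentSpace I x)
    (b := id) (v := X) (w := Y) hX hY

variable [FiniteDimensional ℝ E]

theorem koszul_tensorial_left {Y Z : Π x : M, TangentSpace I x} {x : M}
    (hY : MDiffAt (T% Y) x) (hZ : MDiffAt (T% Z) x) :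
    TensorialAt I E (fun X ↦ koszul I Y X Z x) x where
  smul {f X} hf hX := by
    have : CompleteSpace E := FiniteDimensional.complete ℝ E
    simp only [koszul, Pi.smul_apply', inner_smul_left, inner_smul_right]
    simp [mvfderiv_fun_mul hf (mdifferentiableAt_metric I hZ hX),
      mvfderiv_fun_mul hf (mdifferentiableAt_metric I hX hY),
      mlieBracket_smul_left hf hX, mlieBracket_smul_right hf hX, inner_add_right,
      inner_smul_right, real_inner_comm (X x) (Y x)]
    ring
  add {X X'} hX hX' := by
    have : CompleteSpace E := FiniteDimensional.complete ℝ E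
    simp only [koszul, Pi.add_apply, inner_add_left, inner_add_right]
    simp [mvfderiv_fun_add (mdifferentiableAt_metric I hZ hX) (mdifferentiableAt_metric I hZ hX'),
      mvfderiv_fun_add (mdifferentiableAt_metric I hX hY) (mdifferentiableAt_metric I hX' hY),
      mlieBracket_add_left hX hX', mlieBracket_add_right hX hX', inner_add_right]
    ring

theorem koszul_tensorial_right {Y X : Π x : M, TangentSpace I x} {x : M}
    (hY : MDiffAt (T% Y) x) (hX : MDiffAt (T% X) x) :
    TensorialAt I E (fun Z ↦ koszul I Y X Z x) x where
  smul {f Z} hf hZ := by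
    have : CompleteSpace E := FiniteDimensional.complete ℝ E
    simp only [koszul, Pi.smul_apply', inner_smul_left, inner_smul_right]
    simp [mvfderiv_fun_mul hf (mdifferentiableAt_metric I hZ hX),
      mvfderiv_fun_mul hf (mdifferentiableAt_metric I hY hZ),
      mlieBracket_smul_left hf hZ, mlieBracket_smul_right hf hZ, inner_add_right,
      inner_smul_right, real_inner_comm (X x) (Z x)]
    ring
  add {Z Z'} hZ hZ' := by
    have : CompleteSpace E := FiniteDimensional.complete ℝ E
    simp only [koszul, Pi.add_apply, inner_add_left, inner_add_right]
    simp [mvfderiv_fun_add (mdifferentiableAt_metric I hZ hX) (mdifferentiableAt_metric I hZ' hX),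
      mvfderiv_fun_add (mdifferentiableAt_metric I hY hZ) (mdifferentiableAt_metric I hY hZ'),
      mlieBracket_add_left hZ hZ', mlieBracket_add_right hZ hZ', inner_add_right]
    ring

theorem koszul_add {Y Y' X Z : Π x : M, TangentSpace I x} {x : M}
    (hY : MDiffAt (T% Y) x) (hY' : MDiffAt (T% Y') x)
    (hX : MDiffAt (T% X) x) (hZ : MDiffAt (T% Z) x) :
    koszul I (Y + Y') X Z x = koszul I Y X Z x + koszul I Y' X Z x := by
  have : CompleteSpace E := FiniteDimensional.complete ℝ E
  simp only [koszul, Pi.add_apply, inner_add_left, inner_add_right]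
  simp [mvfderiv_fun_add (mdifferentiableAt_metric I hY hZ) (mdifferentiableAt_metric I hY' hZ),
    mvfderiv_fun_add (mdifferentiableAt_metric I hX hY) (mdifferentiableAt_metric I hX hY'),
    mlieBracket_add_left hY hY', mlieBracket_add_right hY hY', inner_add_right]
  ring

theorem koszul_smul {f : M → ℝ} {Y X Z : Π x : M, TangentSpace I x} {x : M}
    (hf : MDiffAt f x) (hY : MDiffAt (T% Y) x)
    (hX : MDiffAt (T% X) x) (hZ : MDiffAt (T% Z) x) :
    koszul I (f • Y) X Z x = f x * koszul I Y X Z x + d% f x (X x) * inner ℝ (Y x) (Z x) := by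
  have : CompleteSpace E := FiniteDimensional.complete ℝ E
  simp only [koszul, Pi.smul_apply', inner_smul_left, inner_smul_right]
  simp [mvfderiv_fun_mul hf (mdifferentiableAt_metric I hY hZ),
    mvfderiv_fun_mul hf (mdifferentiableAt_metric I hX hY),
    mlieBracket_smul_left hf hY, mlieBracket_smul_right hf hY, inner_add_right,
    inner_smul_right, real_inner_comm (Y x) (Z x)]
  ring

open Classical in
/-- `Y ↦ (v ↦ ∇_v Y)` at the point `x`, where `∇_v Y` is the vector with
`g(∇_X Y, Z) = koszul Y X Z` for all differentiable `X` and `Z`; it is `0` (junk) when `Y` is not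
differentiable at `x`. -/
def leviCivitaFun (Y : Π x : M, TangentSpace I x) (x : M) :
    TangentSpace I x →L[ℝ] TangentSpace I x :=
  have : FiniteDimensional ℝ (TangentSpace I x) := inferInstanceAs (FiniteDimensional ℝ E)
  have : CompleteSpace (TangentSpace I x) := FiniteDimensional.complete ℝ _
  if hY : MDiffAt (T% Y) x then
    let Φ := TensorialAt.mkHom₂ (fun X Z ↦ koszul I Y X Z x) x
      (fun _ hZ ↦ koszul_tensorial_left I hY hZ) (fun _ hX ↦ koszul_tensorial_right I hY hX)
    LinearMap.toContinuousLinearMap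
      { toFun := fun v ↦ (InnerProductSpace.toDual ℝ (TangentSpace I x)).symm (Φ v)
        map_add' := fun v w ↦ by simp
        map_smul' := fun c v ↦ by simp }
  else 0

/-- Koszul's formula. -/
theorem inner_leviCivitaFun {Y X Z : Π x : M, TangentSpace I x} {x : M}
    (hY : MDiffAt (T% Y) x) (hX : MDiffAt (T% X) x) (hZ : MDiffAt (T% Z) x) :
    inner ℝ (leviCivitaFun I Y x (X x)) (Z x) = koszul I Y X Z x := by
  rw [leviCivitaFun, dif_pos hY]
  simp only [LinearMap.coe_toContinuousLinearMap', LinearMap.coe_mk, AddHom.coe_mk,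
    InnerProductSpace.toDual_symm_apply]
  exact TensorialAt.mkHom₂_apply _ _ hX hZ

/-- The Levi-Civita connection of the Riemannian metric of `M`. -/
def leviCivita : CovariantDerivative I E (TangentSpace I : M → Type _) where
  toFun := leviCivitaFun I
  isCovariantDerivativeOnUniv := by
    refine ⟨fun {Y Y' x} hY hY' _ ↦ ?_, fun {Y f x} hY hf _ ↦ ?_⟩
    · ext v
      obtain ⟨X, hX, rfl⟩ : ∃ X : Π x : M, TangentSpace I x, MDiffAt (T% X) x ∧ X x = v :=
        ⟨extend E v, mdifferentiableAt_extend .., by simp⟩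
      refine eq_of_inner_extend I fun Z hZ ↦ ?_
      have hs : MDiffAt (T% (Y + Y')) x := mdifferentiableAt_add_section hY hY'
      rw [inner_leviCivitaFun I hs hX hZ, koszul_add I hY hY' hX hZ]
      simp [inner_add_left, inner_leviCivitaFun I hY hX hZ, inner_leviCivitaFun I hY' hX hZ]
    · ext v
      obtain ⟨X, hX, rfl⟩ : ∃ X : Π x : M, TangentSpace I x, MDiffAt (T% X) x ∧ X x = v :=
        ⟨extend E v, mdifferentiableAt_extend .., by simp⟩
      refine eq_of_inner_extend I fun Z hZ ↦ ?_
      have hs : MDiffAt (T% (f • Y)) x := hf.smul_section hY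
      rw [inner_leviCivitaFun I hs hX hZ, koszul_smul I hf hY hX hZ]
      simp [inner_add_left, inner_smul_left, inner_leviCivitaFun I hY hX hZ]

theorem inner_leviCivita {Y X Z : Π x : M, TangentSpace I x} {x : M}
    (hY : MDiffAt (T% Y) x) (hX : MDiffAt (T% X) x) (hZ : MDiffAt (T% Z) x) :
    inner ℝ (leviCivita I Y x (X x)) (Z x) = koszul I Y X Z x :=
  inner_leviCivitaFun I hY hX hZ

/-- The Levi-Civita connection is torsion-free. -/
theorem leviCivita_torsion_free {X Y : Π x : M, TangentSpace I x} {x : M}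
    (hX : MDiffAt (T% X) x) (hY : MDiffAt (T% Y) x) :
    leviCivita I Y x (X x) - leviCivita I X x (Y x) = mlieBracket I X Y x := by
  refine eq_of_inner_extend I fun Z hZ ↦ ?_
  rw [inner_sub_left, inner_leviCivita I hY hX hZ, inner_leviCivita I hX hY hZ]
  simp only [koszul]
  rw [mlieBracket_swap_apply (V := Z) (W := X), mlieBracket_swap_apply (V := Y) (W := X),
    mlieBracket_swap_apply (V := Z) (W := Y)]
  simp only [inner_neg_right, real_inner_comm (Z _)]
  simp only [real_inner_comm (X _) (Y _)]
  ring

/-- The Levi-Civita connection is compatible with the metric. -/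
theorem leviCivita_metric {X Y Z : Π x : M, TangentSpace I x} {x : M}
    (hX : MDiffAt (T% X) x) (hY : MDiffAt (T% Y) x) (hZ : MDiffAt (T% Z) x) :
    d% (fun y ↦ inner ℝ (Y y) (Z y)) x (X x) =
      inner ℝ (leviCivita I Y x (X x)) (Z x) + inner ℝ (Y x) (leviCivita I Z x (X x)) := by
  rw [← real_inner_comm (Y x), inner_leviCivita I hY hX hZ, inner_leviCivita I hZ hX hY]
  simp only [koszul]
  rw [mlieBracket_swap_apply (V := Z) (W := X), mlieBracket_swap_apply (V := Z) (W := Y),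
    mlieBracket_swap_apply (V := Y) (W := X)]
  simp only [inner_neg_right]
  simp only [real_inner_comm (X _) (Y _), real_inner_comm (Z _)]
  ring

/-- The curvature `R(X, Y) Z = ∇_X ∇_Y Z - ∇_Y ∇_X Z - ∇_[X, Y] Z` of the Levi-Civita connection,
at the point `x`. -/
def curvature (X Y Z : Π x : M, TangentSpace I x) (x : M) : TangentSpace I x :=
  leviCivita I (fun y ↦ leviCivita I Z y (Y y)) x (X x)
    - leviCivita I (fun y ↦ leviCivita I Z y (X y)) x (Y x)
    - leviCivita I Z x (mlieBracket I X Y x)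

/-- An orthonormal basis of the tangent space at `x`. -/
def tangentBasis (x : M) :
    OrthonormalBasis (Fin (Module.finrank ℝ (TangentSpace I x))) ℝ (TangentSpace I x) :=
  have : FiniteDimensional ℝ (TangentSpace I x) := inferInstanceAs (FiniteDimensional ℝ E)
  stdOrthonormalBasis ℝ (TangentSpace I x)

/-- The Ricci tensor `S(v, w)`: the trace of `u ↦ R(u, v) w`, where the curvature tensor is
evaluated on vector fields extending the given tangent vectors smoothly to a neighbourhood. -/
def ricci (x : M) (v w : TangentSpace I x) : ℝ :=
  ∑ i, inner ℝ
    (curvature I (extend E (tangentBasis I x i)) (extend E v) (extend E w) x) (tangentBasis I x i)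

/-- The scalar curvature: the metric trace of the Ricci tensor. -/
def scalarCurvature (x : M) : ℝ :=
  ∑ i, ricci I x (tangentBasis I x i) (tangentBasis I x i)

/-- The covariant derivative `(∇_X S)(Y, Z)` of the Ricci tensor, at the point `x`. -/
def covDerivRicci (X Y Z : Π x : M, TangentSpace I x) (x : M) : ℝ :=
  d% (fun y ↦ ricci I y (Y y) (Z y)) x (X x)
    - ricci I x (leviCivita I Y x (X x)) (Z x) - ricci I x (Y x) (leviCivita I Z x (X x))

variable (M) in
/-- The Ricci tensor is *cyclic parallel*: it is not identically zero, and
`(∇_X S)(Y, Z) + (∇_Y S)(Z, X) + (∇_Z S)(X, Y) = 0` for all vector fields. -/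
def HasCyclicParallelRicci : Prop :=
  (∃ (x : M) (v w : TangentSpace I x), ricci I x v w ≠ 0) ∧
    ∀ (x : M) (X Y Z : Π x : M, TangentSpace I x),
      SmoothFieldAt I X x → SmoothFieldAt I Y x → SmoothFieldAt I Z x →
        covDerivRicci I X Y Z x + covDerivRicci I Y Z X x + covDerivRicci I Z X Y x = 0

/-- The covariant derivative `(∇_X φ) Y = ∇_X (φ Y) - φ (∇_X Y)` of a field `φ` of endomorphisms
of the tangent spaces, at the point `x`. -/
def covDerivEndo (φ : Π x : M, TangentSpace I x →L[ℝ] TangentSpace I x)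
    (X Y : Π x : M, TangentSpace I x) (x : M) : TangentSpace I x :=
  leviCivita I (fun y ↦ φ y (Y y)) x (X x) - φ x (leviCivita I Y x (X x))

/-- A trans-Sasakian structure of type `(α, β)`, for smooth functions `α` and `β`: an almost contact
metric structure such that
`(∇_X φ) Y = α (g(X, Y) ξ - η(Y) X) + β (g(φ X, Y) ξ - η(Y) φ X)` for all vector fields. -/
structure IsTransSasakian (s : AlmostContactMetricStructure I M) (α β : M → ℝ) : Prop where
  smooth_alpha : ContMDiff I 𝓘(ℝ, ℝ) ∞ α
  smooth_beta : ContMDiff I 𝓘(ℝ, ℝ) ∞ β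
  covDeriv_phi : ∀ (x : M) (X Y : Π x : M, TangentSpace I x),
    SmoothFieldAt I X x → SmoothFieldAt I Y x →
      covDerivEndo I s.phi X Y x =
        α x • ((inner ℝ (X x) (Y x) : ℝ) • s.xi x - s.eta x (Y x) • X x)
          + β x • ((inner ℝ (s.phi x (X x)) (Y x) : ℝ) • s.xi x - s.eta x (Y x) • s.phi x (X x))

/-- An `α`-Sasakian structure: a trans-Sasakian structure of type `(α, 0)`. -/
def IsAlphaSasakian (s : AlmostContactMetricStructure I M) (α : M → ℝ) : Prop :=
  IsTransSasakian I s α 0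

/-- `(g, ξ, lam, μ)` is an `η`-Einstein soliton:
`L_ξ g + 2 S + (2 lam - r) g + 2 μ η ⊗ η = 0`. -/
def IsEtaEinsteinSoliton (s : AlmostContactMetricStructure I M) (lam μ : ℝ) : Prop :=
  ∀ (x : M) (X Y : Π x : M, TangentSpace I x),
    SmoothFieldAt I X x → SmoothFieldAt I Y x →
      lieDerivMetric I s.xi X Y x + 2 * ricci I x (X x) (Y x)
        + (2 * lam - scalarCurvature I x) * inner ℝ (X x) (Y x)
        + 2 * μ * (s.eta x (X x) * s.eta x (Y x)) = 0

/-- An `η`-Einstein soliton with constant `lam` is *expanding* if `lam > 0`. -/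
def IsExpanding (lam : ℝ) : Prop := 0 < lam

end
end RiemannianGeometry

open scoped Topology

namespace RiemannianGeometry

/-! The structure equation with $Y=\xi$ yields $\nabla_X\xi=-\alpha\phi X+\beta(X-\eta(X)\xi)$,
hence $\mathcal L_\xi g=2\beta(g-\eta\otimes\eta)$. The soliton equation then expresses $S$ through
$g$ and $\eta\otimes\eta$; its trace in dimension 3 eliminates $r$ (`ricci_eq`):
$S=(2\lambda+\beta+\mu)g+(\beta-\mu)\eta\otimes\eta$.

On the diagonal, cyclic parallelism says $(\nabla_XS)(X,X)=0$, that is (`covDerivRicci_self`)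
$d\beta(X)(|X|^2+\eta(X)^2)+2\beta(\beta-\mu)\eta(X)(|X|^2-\eta(X)^2)=0$. Vectors orthogonal to
$\xi$ and $\xi$ itself give $d\beta=0$; a sum of the two kinds gives $\beta(\beta-\mu)=0$. So
$\beta$ is constant on each component, and that constant is $0$, since $\beta$ differs from $\mu$
somewhere there.

With $\beta=0$ the formula for $S$ gives $S(\xi,\xi)=2\lambda$, while the curvature of an
$\alpha$-Sasakian structure gives $S(\xi,\xi)=2\alpha^2$ (`ricci_xi_xi`). -/

theorem mvfderiv_congr_of_eventuallyEq {E : Type*} [NormedAddCommGroup E] [NormedSpace ℝ E]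
    {H : Type*} [TopologicalSpace H] {I : ModelWithCorners ℝ E H}
    {M : Type*} [TopologicalSpace M] [ChartedSpace H M] {f g : M → ℝ} {x : M}
    (h : f =ᶠ[𝓝 x] g) : d% f x = d% g x := by
  ext v
  exact congrArg (fun L : E →L[ℝ] ℝ ↦ L v) (h.mfderiv_eq (I := I) (I' := 𝓘(ℝ, ℝ)))

/-! ### Smooth vector fields at a point -/

section Fields

variable {E : Type*} [NormedAddCommGroup E] [NormedSpace ℝ E]
  {H : Type*} [TopologicalSpace H] {I : ModelWithCorners ℝ E H}
  {M : Type*} [TopologicalSpace M] [ChartedSpace H M] [IsManifold I ∞ M]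

theorem SmoothFieldAt.mdifferentiableAt {X : Π x : M, TangentSpace I x} {x : M}
    (hX : SmoothFieldAt I X x) : MDiffAt (T% X) x :=
  ContMDiffAt.mdifferentiableAt hX (by simp)

theorem SmoothFieldAt.eventually_mdifferentiableAt {X : Π x : M, TangentSpace I x} {x : M}
    (hX : SmoothFieldAt I X x) : ∀ᶠ y in 𝓝 x, MDiffAt (T% X) y := by
  have h1 : ContMDiffAt I I.tangent 1 (fun y ↦ (⟨y, X y⟩ : TangentBundle I M)) x :=
    ContMDiffAt.of_le hX (by simp)
  exact ((contMDiffAt_iff_contMDiffAt_nhds (by simp)).1 h1).mono fun y hy ↦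
    hy.mdifferentiableAt one_ne_zero

theorem smoothFieldAt_extend {x : M} (v : TangentSpace I x) : SmoothFieldAt I (extend E v) x :=
  contMDiffAt_extend I E v

theorem SmoothFieldAt.sub {X Y : Π x : M, TangentSpace I x} {x : M}
    (hX : SmoothFieldAt I X x) (hY : SmoothFieldAt I Y x) : SmoothFieldAt I (X - Y) x :=
  ContMDiffAt.sub_section hX hY

theorem SmoothFieldAt.smul {f : M → ℝ} {X : Π x : M, TangentSpace I x} {x : M}
    (hf : ContMDiffAt I 𝓘(ℝ, ℝ) ∞ f x) (hX : SmoothFieldAt I X x) : SmoothFieldAt I (f • X) x :=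
  ContMDiffAt.smul_section hf hX

theorem SmoothFieldAt.congr_of_eventuallyEq {X Y : Π x : M, TangentSpace I x} {x : M}
    (hX : SmoothFieldAt I X x) (h : ∀ᶠ y in 𝓝 x, Y y = X y) : SmoothFieldAt I Y x :=
  ContMDiffAt.congr_of_eventuallyEq hX (h.mono fun y hy ↦ by simp [hy])

theorem eventually_mdifferentiableAt_of_contMDiffAt {f : M → ℝ} {x : M}
    (hf : ContMDiffAt I 𝓘(ℝ, ℝ) ∞ f x) : ∀ᶠ y in 𝓝 x, MDiffAt f y :=
  ((contMDiffAt_iff_contMDiffAt_nhds (by simp)).1 (hf.of_le (m := 1) (by simp))).mono fun y hy ↦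
    hy.mdifferentiableAt one_ne_zero

theorem SmoothFieldAt.mlieBracket [CompleteSpace E] {X Y : Π x : M, TangentSpace I x} {x : M}
    (hX : SmoothFieldAt I X x) (hY : SmoothFieldAt I Y x) :
    SmoothFieldAt I (mlieBracket I X Y) x := by
  have : IsManifold I (((⊤ : ℕ∞) : ℕ∞ω) + 1) M := (inferInstance : IsManifold I ∞ M)
  have : IsManifold I (minSmoothness ℝ 2) M := by simpa using! (inferInstance : IsManifold I 2 M)
  exact ContMDiffAt.mlieBracket_vectorField (n := ⊤) (m := ⊤) hX hY (by simp)

end Fields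

/-! ### Smoothness of metric derivatives, and skew-symmetry of curvature -/

section Metric

variable {E : Type*} [NormedAddCommGroup E] [NormedSpace ℝ E]
  {H : Type*} [TopologicalSpace H] {I : ModelWithCorners ℝ E H}
  {M : Type*} [TopologicalSpace M] [ChartedSpace H M]
  [RiemannianBundle (fun x : M ↦ TangentSpace I x)] [IsManifold I ∞ M]
  [IsContMDiffRiemannianBundle I ∞ E (fun x : M ↦ TangentSpace I x)]

theorem SmoothFieldAt.inner {X Y : Π x : M, TangentSpace I x} {x : M}
    (hX : SmoothFieldAt I X x) (hY : SmoothFieldAt I Y x) :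
    ContMDiffAt I 𝓘(ℝ, ℝ) ∞ (fun y ↦ inner ℝ (X y) (Y y)) x :=
  ContMDiffAt.inner_bundle (IB := I) (F := E) (E := fun x : M ↦ TangentSpace I x)
    (b := id) (v := X) (w := Y) hX hY

/-- The derivative of a smooth function along a smooth vector field is smooth. -/
theorem contMDiffAt_mvfderiv_apply [CompleteSpace E] {f : M → ℝ} {Y : Π x : M, TangentSpace I x}
    {x : M} (hf : ContMDiffAt I 𝓘(ℝ, ℝ) ∞ f x) (hY : SmoothFieldAt I Y x) :
    ContMDiffAt I 𝓘(ℝ, ℝ) ∞ (fun y ↦ d% f y (Y y)) x := by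
  -- If $W(x)\ne0$, the identity $[Y,fW]-f[Y,W]=(Yf)W$, paired with $W$ and divided by $|W|^2$,
  -- writes $Yf$ through smooth data. With no nonzero tangent vector the dimension is zero.
  by_cases h : ∃ w : TangentSpace I x, w ≠ 0
  · obtain ⟨w, hw⟩ := h
    set W : Π x : M, TangentSpace I x := extend E w with hWdef
    have hW : SmoothFieldAt I W x := smoothFieldAt_extend w
    have hWx : W x = w := by simp [hWdef]
    have hne : (inner ℝ (W x) (W x) : ℝ) ≠ 0 := by rw [hWx]; exact inner_self_ne_zero.2 hw
    have hsm : ContMDiffAt I 𝓘(ℝ, ℝ) ∞ (fun y ↦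
        (inner ℝ ((mlieBracket I Y (f • W) - f • mlieBracket I Y W) y) (W y) : ℝ)
          * (inner ℝ (W y) (W y))⁻¹) x :=
      (((hY.mlieBracket (hW.smul hf)).sub ((hY.mlieBracket hW).smul hf)).inner hW).mul
        ((hW.inner hW).inv₀ hne)
    refine hsm.congr_of_eventuallyEq ?_
    filter_upwards [(hW.inner hW).continuousAt.eventually_ne hne,
      eventually_mdifferentiableAt_of_contMDiffAt hf, hW.eventually_mdifferentiableAt]
      with y hy hfy hWy
    rw [Pi.sub_apply, mlieBracket_smul_right hfy hWy]
    simp only [Pi.smul_apply', add_sub_cancel_right, inner_smul_left]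
    simp only [conj_trivial]
    rw [mul_assoc, mul_inv_cancel₀ hy, mul_one]
  · push Not at h
    have hE : Subsingleton E := ⟨fun a b ↦ (h a).trans (h b).symm⟩
    have : (fun y ↦ d% f y (Y y)) = fun _ ↦ (0 : ℝ) := by
      funext y
      rw [show Y y = 0 from Subsingleton.elim (α := E) _ _, map_zero]
    rw [this]
    exact contMDiffAt_const

/-- Expand the Jacobi identity for $X,Y,fW$ and use the one for $X,Y,W$: what remains is this
identity multiplied by $W$, and $W(x)\ne0$. -/
theorem mvfderiv_mlieBracket [CompleteSpace E] {f : M → ℝ} {X Y : Π x : M, TangentSpace I x}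
    {x : M} (hf : ContMDiffAt I 𝓘(ℝ, ℝ) ∞ f x) (hX : SmoothFieldAt I X x)
    (hY : SmoothFieldAt I Y x) :
    d% f x (mlieBracket I X Y x)
      = d% (fun y ↦ d% f y (Y y)) x (X x) - d% (fun y ↦ d% f y (X y)) x (Y x) := by
  by_cases h : ∃ w : TangentSpace I x, w ≠ 0
  · obtain ⟨w, hw⟩ := h
    set W : Π x : M, TangentSpace I x := extend E w with hWdef
    have hW : SmoothFieldAt I W x := smoothFieldAt_extend w
    have hWx : W x = w := by simp [hWdef]
    have hfd : MDiffAt f x := hf.mdifferentiableAt (by simp)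
    have key : ∀ {A B : Π x : M, TangentSpace I x}, SmoothFieldAt I A x → SmoothFieldAt I B x →
        mlieBracket I A (mlieBracket I B (f • W)) x
          = d% (fun y ↦ d% f y (B y)) x (A x) • W x + d% f x (B x) • mlieBracket I A W x
            + (d% f x (A x) • mlieBracket I B W x
              + f x • mlieBracket I A (mlieBracket I B W) x) := by
      intro A B hA hB
      have hBf := contMDiffAt_mvfderiv_apply hf hB
      have e : (mlieBracket I B (f • W)) =ᶠ[𝓝 x]
          ((fun y ↦ d% f y (B y)) • W + f • mlieBracket I B W : Π x : M, TangentSpace I x) := by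
        filter_upwards [eventually_mdifferentiableAt_of_contMDiffAt hf,
          hW.eventually_mdifferentiableAt] with y hfy hWy
        rw [mlieBracket_smul_right hfy hWy]
        rfl
      rw [Filter.EventuallyEq.mlieBracket_vectorField_eq (Filter.EventuallyEq.refl _ A) e,
        mlieBracket_add_right (hW.smul hBf).mdifferentiableAt
          ((hB.mlieBracket hW).smul hf).mdifferentiableAt,
        mlieBracket_smul_right (hBf.mdifferentiableAt (by simp)) hW.mdifferentiableAt,
        mlieBracket_smul_right hfd (hB.mlieBracket hW).mdifferentiableAt]
    have h2 : ∀ {A : Π x : M, TangentSpace I x}, SmoothFieldAt I A x →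
        ContMDiffAt I I.tangent (minSmoothness ℝ 2) (fun y ↦ (⟨y, A y⟩ : TangentBundle I M)) x :=
      fun hA ↦ ContMDiffAt.of_le hA (by simpa using ENat.LEInfty.out)
    have : IsManifold I (minSmoothness ℝ 3) M := by
      have : IsManifold I 3 M := IsManifold.of_le (n := ∞) ENat.LEInfty.out
      simpa using! this
    have J := leibniz_identity_mlieBracket_apply (h2 hX) (h2 hY) (h2 (hW.smul hf))
    have J' := leibniz_identity_mlieBracket_apply (h2 hX) (h2 hY) (h2 hW)
    rw [key hX hY, key hY hX, mlieBracket_smul_right hfd hW.mdifferentiableAt, J'] at J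
    rw [← hWx] at hw
    refine smul_left_injective ℝ hw ?_
    simp only [sub_smul]
    rw [eq_sub_iff_add_eq]
    have J2 := sub_eq_zero.2 J
    rw [← sub_eq_zero, ← neg_eq_zero, ← J2]
    simp only [smul_add]
    abel
  · push Not at h
    have h0 : ∀ v : TangentSpace I x, v = 0 := h
    rw [h0 (X x), h0 (Y x), h0 (mlieBracket I X Y x)]
    simp

variable [FiniteDimensional ℝ E]

/-- A vector field is smooth if its inner products with all smooth vector fields are smooth. -/
theorem smoothFieldAt_of_inner {U : Π x : M, TangentSpace I x} {x : M}
    (h : ∀ W : Π x : M, TangentSpace I x, SmoothFieldAt I W x →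
      ContMDiffAt I 𝓘(ℝ, ℝ) ∞ (fun y ↦ inner ℝ (U y) (W y)) x) : SmoothFieldAt I U x := by
  classical
  let b := Module.finBasis ℝ E
  let t := trivializationAt E (TangentSpace I : M → Type _) x
  have hx : x ∈ t.baseSet := FiberBundle.mem_baseSet_trivializationAt E _ x
  let s := t.localFrame b
  have hs (i) : SmoothFieldAt I (s i) x := contMDiffAt_localFrame_of_mem ∞ _ b i hx
  -- The frame coefficients of $U$ are the inverse Gram matrix applied to the inner products of $U$
  -- with the frame. The inverse is smooth because determinant and adjugate are polynomial in the
  -- entries.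
  let G : M → Matrix (Fin (Module.finrank ℝ E)) (Fin (Module.finrank ℝ E)) ℝ :=
    fun y ↦ Matrix.gram ℝ (fun i ↦ s i y)
  have hdet : ∀ y ∈ t.baseSet, (G y).det ≠ 0 := fun y hy ↦
    Matrix.det_gram_ne_zero_iff_linearIndependent.2
      ((t.isLocalFrameOn_localFrame_baseSet I ∞ b).linearIndependent hy)
  have hGsm : ContMDiffAt I 𝓘(ℝ, Fin (Module.finrank ℝ E) → Fin (Module.finrank ℝ E) → ℝ) ∞
      (fun y i j ↦ (inner ℝ (s i y) (s j y) : ℝ)) x :=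
    contMDiffAt_pi_space.2 fun i ↦ contMDiffAt_pi_space.2 fun j ↦ (hs i).inner (hs j)
  have hdetsm : ContMDiffAt I 𝓘(ℝ, ℝ) ∞ (fun y ↦ (G y).det) x := by
    have : ContDiff ℝ ∞ (fun A : Fin (Module.finrank ℝ E) → Fin (Module.finrank ℝ E) → ℝ ↦
        (Matrix.of A).det) := by
      simp only [Matrix.det_apply, Matrix.of_apply]
      fun_prop
    exact this.contMDiff.contMDiffAt.comp x hGsm
  have hadj (i j) : ContMDiffAt I 𝓘(ℝ, ℝ) ∞ (fun y ↦ (G y).adjugate i j) x := by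
    have : ContDiff ℝ ∞ (fun A : Fin (Module.finrank ℝ E) → Fin (Module.finrank ℝ E) → ℝ ↦
        (Matrix.of A).adjugate i j) := by
      simp only [Matrix.adjugate_apply, Matrix.det_apply]
      refine ContDiff.sum fun σ _ ↦ ContDiff.const_smul _ (contDiff_prod fun k _ ↦ ?_)
      by_cases hk : σ k = j
      · simp only [hk, Matrix.updateRow_self]
        fun_prop
      · simp only [Matrix.updateRow_ne hk, Matrix.of_apply]
        fun_prop
    exact this.contMDiff.contMDiffAt.comp x hGsm
  refine (contMDiffAt_iff_localFrameCoeff (e := t) b hx).2 fun i ↦ ?_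
  have hsm : ContMDiffAt I 𝓘(ℝ, ℝ) ∞ (fun y ↦ ∑ j, (G y).det⁻¹ * ((G y).adjugate i j *
      inner ℝ (U y) (s j y))) x :=
    contMDiffAt_finsetSum fun j _ ↦
      (hdetsm.inv₀ (hdet x hx)).mul ((hadj i j).mul (h _ (hs j)))
  refine hsm.congr_of_eventuallyEq ?_
  filter_upwards [t.open_baseSet.mem_nhds hx] with y hy
  set c : Fin (Module.finrank ℝ E) → ℝ := fun k ↦ t.localFrameCoeff I b k y (U y) with hc
  have hU : U y = ∑ k, c k • s k y := t.eq_sum_localFrameCoeff_smul hy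
  have hmul : (fun j ↦ (inner ℝ (U y) (s j y) : ℝ)) = (G y).mulVec c := by
    funext j
    rw [hU, sum_inner]
    simp only [inner_smul_left, Matrix.mulVec, dotProduct, G, Matrix.gram_apply]
    refine Finset.sum_congr rfl fun k _ ↦ ?_
    rw [real_inner_comm (s k y)]
    simp [mul_comm]
  have h3 : (G y)⁻¹.mulVec ((G y).mulVec c) = c := by
    rw [Matrix.mulVec_mulVec, Matrix.nonsing_inv_mul _ (isUnit_iff_ne_zero.2 (hdet y hy)),
      Matrix.one_mulVec]
  rw [← hmul] at h3
  have h4 := congrFun h3 i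
  change c i = _
  rw [← h4]
  simp [Matrix.mulVec, dotProduct, Matrix.inv_def, mul_assoc]

theorem contMDiffAt_koszul {Y X Z : Π x : M, TangentSpace I x} {x : M}
    (hY : SmoothFieldAt I Y x) (hX : SmoothFieldAt I X x) (hZ : SmoothFieldAt I Z x) :
    ContMDiffAt I 𝓘(ℝ, ℝ) ∞ (koszul I Y X Z) x := by
  have : CompleteSpace E := FiniteDimensional.complete ℝ E
  have h := ((((((contMDiffAt_mvfderiv_apply (hY.inner hZ) hX).add
    (contMDiffAt_mvfderiv_apply (hZ.inner hX) hY)).sub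
    (contMDiffAt_mvfderiv_apply (hX.inner hY) hZ)).sub
    (hX.inner (hY.mlieBracket hZ))).add (hY.inner (hZ.mlieBracket hX))).add
    (hZ.inner (hX.mlieBracket hY))).mul
    (contMDiffAt_const (c := (2 : ℝ)⁻¹))
  exact h

/-- The Levi-Civita derivative of a smooth vector field along a smooth vector field is smooth. -/
theorem SmoothFieldAt.leviCivita {Y X : Π x : M, TangentSpace I x} {x : M}
    (hY : SmoothFieldAt I Y x) (hX : SmoothFieldAt I X x) :
    SmoothFieldAt I (fun y ↦ leviCivita I Y y (X y)) x := by
  refine smoothFieldAt_of_inner fun W hW ↦ ?_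
  refine (contMDiffAt_koszul hY hX hW).congr_of_eventuallyEq ?_
  filter_upwards [hY.eventually_mdifferentiableAt, hX.eventually_mdifferentiableAt,
    hW.eventually_mdifferentiableAt] with y h1 h2 h3
  exact inner_leviCivita I h1 h2 h3

/-- The endomorphism `R(X, Y)` is skew-symmetric with respect to the metric. -/
theorem inner_curvature_skew {X Y Z W : Π x : M, TangentSpace I x} {x : M}
    (hX : SmoothFieldAt I X x) (hY : SmoothFieldAt I Y x)
    (hZ : SmoothFieldAt I Z x) (hW : SmoothFieldAt I W x) :
    (inner ℝ (curvature I X Y Z x) (W x) : ℝ) = -inner ℝ (Z x) (curvature I X Y W x) := by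
  have : CompleteSpace E := FiniteDimensional.complete ℝ E
  have second : ∀ {A B : Π x : M, TangentSpace I x}, SmoothFieldAt I A x → SmoothFieldAt I B x →
      d% (fun y ↦ d% (fun z ↦ (inner ℝ (Z z) (W z) : ℝ)) y (B y)) x (A x)
        = (inner ℝ (leviCivita I (fun y ↦ leviCivita I Z y (B y)) x (A x)) (W x)
            + inner ℝ (leviCivita I Z x (B x)) (leviCivita I W x (A x)))
          + (inner ℝ (leviCivita I Z x (A x)) (leviCivita I W x (B x))
            + inner ℝ (Z x) (leviCivita I (fun y ↦ leviCivita I W y (B y)) x (A x))) := by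
    intro A B hA hB
    have e : (fun y ↦ d% (fun z ↦ (inner ℝ (Z z) (W z) : ℝ)) y (B y)) =ᶠ[𝓝 x]
        fun y ↦ (inner ℝ (leviCivita I Z y (B y)) (W y) : ℝ)
          + inner ℝ (Z y) (leviCivita I W y (B y)) := by
      filter_upwards [hB.eventually_mdifferentiableAt, hZ.eventually_mdifferentiableAt,
        hW.eventually_mdifferentiableAt] with y h1 h2 h3
      exact leviCivita_metric I h1 h2 h3
    have hZB := (hZ.leviCivita hB).mdifferentiableAt
    have hWB := (hW.leviCivita hB).mdifferentiableAt
    rw [mvfderiv_congr_of_eventuallyEq e, mvfderiv_fun_add (mdifferentiableAt_metric I hZB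
        hW.mdifferentiableAt) (mdifferentiableAt_metric I hZ.mdifferentiableAt hWB),
      add_apply, leviCivita_metric I hA.mdifferentiableAt hZB
        hW.mdifferentiableAt, leviCivita_metric I hA.mdifferentiableAt hZ.mdifferentiableAt hWB]
  -- Apply $[X,Y]=XY-YX$ to $g(Z,W)$: the products of first derivatives are symmetric in $X,Y$ and
  -- cancel.
  have h1 := mvfderiv_mlieBracket (hZ.inner hW) hX hY
  rw [second hX hY, second hY hX, leviCivita_metric I (hX.mlieBracket hY).mdifferentiableAt
    hZ.mdifferentiableAt hW.mdifferentiableAt] at h1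
  simp only [curvature, inner_sub_left, inner_sub_right]
  linarith

end Metric

/-! ### Functions with vanishing differential -/

section LocallyConstant

variable {E : Type*} [NormedAddCommGroup E] [NormedSpace ℝ E]
  {H : Type*} [TopologicalSpace H] {I : ModelWithCorners ℝ E H} [I.Boundaryless]
  {M : Type*} [TopologicalSpace M] [ChartedSpace H M] [IsManifold I 1 M]

/-- Without boundary, the chart target contains a ball around the image of the point; the ball is
convex, so a function with zero derivative is constant on it. -/
theorem isLocallyConstant_of_mvfderiv_eq_zero {f : M → ℝ} (hf : MDiff f)
    (h : ∀ x, d% f x = 0) : IsLocallyConstant f := by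
  rw [IsLocallyConstant.iff_eventually_eq]
  intro x
  have htgt : (extChartAt I x).target ∈ 𝓝 (extChartAt I x x) := extChartAt_target_mem_nhds x
  obtain ⟨r, hr, hball⟩ := Metric.mem_nhds_iff.1 htgt
  have hderiv : ∀ z ∈ Metric.ball (extChartAt I x x) r,
      HasFDerivAt (f ∘ (extChartAt I x).symm) (0 : E →L[ℝ] ℝ) z := by
    intro z hz
    have h1 : MDifferentiableAt 𝓘(ℝ, E) I (extChartAt I x).symm z :=
      (mdifferentiableOn_extChartAt_symm (I := I) z (hball hz)).mdifferentiableAt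
        ((isOpen_extChartAt_target x).mem_nhds (hball hz))
    have h2 := (hf ((extChartAt I x).symm z)).hasMFDerivAt.comp z h1.hasMFDerivAt
    have h3 : mfderiv I 𝓘(ℝ, ℝ) f ((extChartAt I x).symm z) = 0 := h _
    rw [h3, ContinuousLinearMap.zero_comp] at h2
    exact h2.hasFDerivAt
  have hsrc : ∀ᶠ y in 𝓝 x, y ∈ (extChartAt I x).source ∧
      extChartAt I x y ∈ Metric.ball (extChartAt I x x) r :=
    (show ∀ᶠ y in 𝓝 x, y ∈ (extChartAt I x).source from extChartAt_source_mem_nhds x).and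
      ((continuousAt_extChartAt x).eventually (Metric.ball_mem_nhds _ hr))
  filter_upwards [hsrc] with y hy
  have hc := (convex_ball (extChartAt I x x) r).is_const_of_fderivWithin_eq_zero (𝕜 := ℝ)
    (f := f ∘ (extChartAt I x).symm)
    (fun z hz ↦ (hderiv z hz).differentiableAt.differentiableWithinAt)
    (fun z hz ↦ by
      rw [fderivWithin_of_isOpen Metric.isOpen_ball hz, (hderiv z hz).fderiv])
    hy.2 (Metric.mem_ball_self hr)
  simpa only [Function.comp_apply, (extChartAt I x).left_inv hy.1,
    (extChartAt I x).left_inv (mem_extChartAt_source x)] using hc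

end LocallyConstant

end RiemannianGeometry

namespace RiemannianGeometry

theorem sum_inner_tangentBasis {E : Type*} [NormedAddCommGroup E] [NormedSpace ℝ E]
    {H : Type*} [TopologicalSpace H] {I : ModelWithCorners ℝ E H}
    {M : Type*} [TopologicalSpace M] [ChartedSpace H M]
    [RiemannianBundle (fun x : M ↦ TangentSpace I x)] [FiniteDimensional ℝ E] (x : M) :
    ∑ i, (inner ℝ (tangentBasis I x i) (tangentBasis I x i) : ℝ) = Module.finrank ℝ E := by
  simp only [OrthonormalBasis.inner_eq_one, Finset.sum_const, Finset.card_univ, Fintype.card_fin,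
    nsmul_eq_mul, mul_one]
  rfl

variable {E : Type*} [NormedAddCommGroup E] [NormedSpace ℝ E]
  {H : Type*} [TopologicalSpace H] {I : ModelWithCorners ℝ E H}
  {M : Type*} [TopologicalSpace M] [ChartedSpace H M]
  [RiemannianBundle (fun x : M ↦ TangentSpace I x)] [IsManifold I ∞ M]

/-! ### Pointwise algebra of almost contact metric structures -/

namespace AlmostContactMetricStructure

variable (s : AlmostContactMetricStructure I M)

theorem inner_xi_xi (x : M) : (inner ℝ (s.xi x) (s.xi x) : ℝ) = 1 := by
  rw [← s.eta_eq_inner, s.eta_xi]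

/-- $|\phi\xi|^2=|\xi|^2-\eta(\xi)^2=0$. -/
theorem phi_xi (x : M) : s.phi x (s.xi x) = 0 := by
  have h := s.inner_phi_phi x (s.xi x) (s.xi x)
  rw [s.inner_xi_xi, s.eta_xi] at h
  exact inner_self_eq_zero.1 (h.trans (by norm_num))

theorem inner_phi_right (x : M) (v w : TangentSpace I x) :
    (inner ℝ v (s.phi x w) : ℝ) = -inner ℝ (s.phi x v) w := by
  rw [real_inner_comm w]
  exact eq_neg_of_add_eq_zero_left (s.inner_phi_skew x v w)

theorem inner_phi_self (x : M) (v : TangentSpace I x) : (inner ℝ (s.phi x v) v : ℝ) = 0 := by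
  have h := s.inner_phi_skew x v v
  rw [real_inner_comm]
  linarith

theorem eta_phi (x : M) (v : TangentSpace I x) : s.eta x (s.phi x v) = 0 := by
  rw [s.eta_eq_inner, real_inner_comm, s.inner_phi_right, s.phi_xi, inner_zero_left, neg_zero]

theorem smoothFieldAt_phi {X : Π x : M, TangentSpace I x} {x : M} (hX : SmoothFieldAt I X x) :
    SmoothFieldAt I (fun y ↦ s.phi y (X y)) x :=
  ContMDiffAt.clm_bundle_apply (s.smooth_phi x) hX

/-- A unit vector orthogonal to `ξ`. -/
theorem exists_unit_orthogonal [FiniteDimensional ℝ E] (hE : 1 < Module.finrank ℝ E) (x : M) :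
    ∃ v : TangentSpace I x, (inner ℝ v v : ℝ) = 1 ∧ s.eta x v = 0 := by
  have : FiniteDimensional ℝ (TangentSpace I x) := inferInstanceAs (FiniteDimensional ℝ E)
  have hfin : Module.finrank ℝ ℝ < Module.finrank ℝ (TangentSpace I x) := by
    rw [Module.finrank_self]
    exact hE
  obtain ⟨v, hv, hv0⟩ := Submodule.exists_mem_ne_zero_of_ne_bot
    (LinearMap.ker_ne_bot_of_finrank_lt (f := (s.eta x).toLinearMap) hfin)
  have hn : ‖v‖ ≠ 0 := norm_ne_zero_iff.2 hv0
  have hv1 : s.eta x v = 0 := hv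
  refine ⟨‖v‖⁻¹ • v, ?_, by simp [hv1]⟩
  rw [inner_smul_left, inner_smul_right, real_inner_self_eq_norm_sq]
  simp only [conj_trivial]
  field_simp

/-- Parseval for the unit vector $\xi$; this is the trace of $\eta\otimes\eta$. -/
theorem sum_eta_sq [FiniteDimensional ℝ E] (x : M) :
    ∑ i, s.eta x (tangentBasis I x i) * s.eta x (tangentBasis I x i) = 1 := by
  have h := (tangentBasis I x).sum_inner_mul_inner (s.xi x) (s.xi x)
  rw [s.inner_xi_xi] at h
  rw [← h]
  refine Finset.sum_congr rfl fun i _ ↦ ?_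
  rw [s.eta_eq_inner, real_inner_comm (s.xi x)]

end AlmostContactMetricStructure

/-! ### The Ricci tensor of the soliton and the equations for $\beta$ -/

variable [IsContMDiffRiemannianBundle I ∞ E (fun x : M ↦ TangentSpace I x)]
  [FiniteDimensional ℝ E] {s : AlmostContactMetricStructure I M} {α β : M → ℝ}

theorem inner_leviCivita_xi_xi (s : AlmostContactMetricStructure I M) (x : M)
    (v : TangentSpace I x) : (inner ℝ (leviCivita I s.xi x v) (s.xi x) : ℝ) = 0 := by
  have h := leviCivita_metric I (x := x) (smoothFieldAt_extend v).mdifferentiableAt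
    (s.smooth_xi x).mdifferentiableAt (s.smooth_xi x).mdifferentiableAt
  simp only [s.inner_xi_xi, extend_apply_self, mvfderiv_const] at h
  rw [real_inner_comm (leviCivita I s.xi x v), zero_apply] at h
  linarith

/-- `∇_X ξ = -α φ X + β (X - η(X) ξ)`. -/
theorem IsTransSasakian.leviCivita_xi (hs : IsTransSasakian I s α β) (x : M)
    (v : TangentSpace I x) :
    leviCivita I s.xi x v = -(α x • s.phi x v) + β x • (v - s.eta x v • s.xi x) := by
  have h := hs.covDeriv_phi x (extend E v) s.xi (smoothFieldAt_extend v) (s.smooth_xi x)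
  have h0 : (fun y ↦ s.phi y (s.xi y)) = (0 : Π y : M, TangentSpace I y) :=
    funext fun y ↦ s.phi_xi y
  rw [covDerivEndo, h0, CovariantDerivative.zero] at h
  simp only [extend_apply_self, Pi.zero_apply, zero_apply, zero_sub, s.eta_xi, one_smul,
    ← s.eta_eq_inner, s.eta_phi, zero_smul] at h
  -- `h` determines only $\phi(\nabla_v\xi)$. Since $\nabla_v\xi\perp\xi$, applying $\phi$ once more
  -- recovers $\nabla_v\xi$ itself.
  have h1 := congrArg (s.phi x) h
  have h2 : s.eta x (leviCivita I s.xi x v) = 0 := by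
    rw [s.eta_eq_inner, inner_leviCivita_xi_xi]
  simp only [map_neg, s.phi_phi, h2, map_add, map_smul, map_sub, s.phi_xi] at h1
  simp only [zero_smul, add_zero, neg_neg, smul_zero, zero_sub] at h1
  rw [h1]
  simp only [smul_neg, smul_sub, smul_add]
  abel

/-- The $\alpha$-term drops out because $\phi$ is skew. -/
theorem IsTransSasakian.inner_leviCivita_xi_add (hs : IsTransSasakian I s α β) (x : M)
    (v w : TangentSpace I x) :
    (inner ℝ (leviCivita I s.xi x v) w + inner ℝ v (leviCivita I s.xi x w) : ℝ)
      = 2 * β x * (inner ℝ v w - s.eta x v * s.eta x w) := by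
  rw [hs.leviCivita_xi, hs.leviCivita_xi]
  simp only [inner_add_left, inner_add_right, inner_sub_left, inner_sub_right, inner_neg_left,
    inner_neg_right, real_inner_smul_left, real_inner_smul_right, s.inner_phi_right,
    ← s.eta_eq_inner]
  rw [real_inner_comm w (s.xi x), ← s.eta_eq_inner]
  ring

/-- `L_ξ g = 2 β (g - η ⊗ η)`. -/
theorem IsTransSasakian.lieDerivMetric_xi (hs : IsTransSasakian I s α β)
    {X Y : Π x : M, TangentSpace I x} {x : M} (hX : SmoothFieldAt I X x)
    (hY : SmoothFieldAt I Y x) :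
    lieDerivMetric I s.xi X Y x
      = 2 * β x * (inner ℝ (X x) (Y x) - s.eta x (X x) * s.eta x (Y x)) := by
  have hξ := (s.smooth_xi x).mdifferentiableAt
  rw [← hs.inner_leviCivita_xi_add, lieDerivMetric,
    leviCivita_metric I hξ hX.mdifferentiableAt hY.mdifferentiableAt,
    ← leviCivita_torsion_free I hξ hX.mdifferentiableAt,
    ← leviCivita_torsion_free I hξ hY.mdifferentiableAt]
  simp only [inner_sub_left, inner_sub_right]
  ring

/-- The Ricci tensor of a three-dimensional trans-Sasakian `η`-Einstein soliton:
`S = (2 lam + β + μ) g + (β - μ) η ⊗ η`. -/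
theorem IsEtaEinsteinSoliton.ricci_eq {lam μ : ℝ} (hsol : IsEtaEinsteinSoliton I s lam μ)
    (hs : IsTransSasakian I s α β) (hE : Module.finrank ℝ E = 3) (x : M)
    (v w : TangentSpace I x) :
    ricci I x v w = (2 * lam + β x + μ) * inner ℝ v w
      + (β x - μ) * (s.eta x v * s.eta x w) := by
  have key : ∀ v w : TangentSpace I x, ricci I x v w
      = (scalarCurvature I x / 2 - lam - β x) * inner ℝ v w
        + (β x - μ) * (s.eta x v * s.eta x w) := by
    intro v w
    have h := hsol x (extend E v) (extend E w) (smoothFieldAt_extend v) (smoothFieldAt_extend w)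
    rw [hs.lieDerivMetric_xi (smoothFieldAt_extend v) (smoothFieldAt_extend w)] at h
    simp only [extend_apply_self] at h
    linarith
  -- The trace of `key`, with $\operatorname{tr}g=3$; it is solved for $r$ below.
  have htr : scalarCurvature I x = (scalarCurvature I x / 2 - lam - β x) * 3 + (β x - μ) := by
    conv_lhs => rw [scalarCurvature]
    simp only [key, Finset.sum_add_distrib, ← Finset.mul_sum, s.sum_eta_sq, sum_inner_tangentBasis,
      hE]
    norm_num
  rw [key, show scalarCurvature I x / 2 - lam - β x = 2 * lam + β x + μ by linarith]

/-- The diagonal is enough, since the cyclic sum at $X=Y=Z$ is three times it. Terms in $\nabla_XX$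
cancel by metric compatibility; besides $d\beta$, only $g(X,\nabla_X\xi)$ survives, from
differentiating $\eta(X)$. -/
theorem IsEtaEinsteinSoliton.covDerivRicci_self {lam μ : ℝ}
    (hsol : IsEtaEinsteinSoliton I s lam μ) (hs : IsTransSasakian I s α β)
    (hE : Module.finrank ℝ E = 3) {X : Π x : M, TangentSpace I x} {x : M}
    (hX : SmoothFieldAt I X x) :
    covDerivRicci I X X X x
      = d% β x (X x) * (inner ℝ (X x) (X x) + s.eta x (X x) ^ 2)
        + 2 * (β x - μ) * β x * s.eta x (X x) * (inner ℝ (X x) (X x) - s.eta x (X x) ^ 2) := by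
  have hXd := hX.mdifferentiableAt
  have hξ := (s.smooth_xi x).mdifferentiableAt
  have hβ : MDiffAt β x := (hs.smooth_beta x).mdifferentiableAt (by simp)
  have hg := mdifferentiableAt_metric I hXd hXd
  have hη := mdifferentiableAt_metric I hXd hξ
  have hc : MDiffAt (fun y ↦ 2 * lam + β y) x := mdifferentiableAt_const.add hβ
  have ha : MDiffAt (fun y ↦ 2 * lam + β y + μ) x := hc.add mdifferentiableAt_const
  have hb : MDiffAt (fun y ↦ β y - μ) x := hβ.sub mdifferentiableAt_const
  have hda : d% (fun y ↦ 2 * lam + β y + μ) x = d% β x := by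
    rw [mvfderiv_fun_add hc mdifferentiableAt_const,
      mvfderiv_fun_add mdifferentiableAt_const hβ, mvfderiv_const, mvfderiv_const, zero_add,
      add_zero]
  have hdb : d% (fun y ↦ β y - μ) x = d% β x := by
    rw [mvfderiv_fun_sub hβ mdifferentiableAt_const, mvfderiv_const, sub_zero]
  have hηη : MDiffAt (fun y ↦ (inner ℝ (X y) (s.xi y) : ℝ) * inner ℝ (X y) (s.xi y)) x := hη.mul hη
  have hag : MDiffAt (fun y ↦ (2 * lam + β y + μ) * (inner ℝ (X y) (X y) : ℝ)) x := ha.mul hg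
  have hbη : MDiffAt (fun y ↦ (β y - μ) *
      ((inner ℝ (X y) (s.xi y) : ℝ) * inner ℝ (X y) (s.xi y))) x := hb.mul hηη
  have hsym := hs.inner_leviCivita_xi_add x (X x) (X x)
  rw [real_inner_comm (X x)] at hsym
  rw [covDerivRicci]
  simp only [hsol.ricci_eq hs hE, s.eta_eq_inner] at hsym ⊢
  rw [mvfderiv_fun_add hag hbη, mvfderiv_fun_mul ha hg,
    mvfderiv_fun_mul hb hηη, mvfderiv_fun_mul hη hη]
  simp only [add_apply, smul_apply, smul_eq_mul, hda, hdb, leviCivita_metric I hXd hXd hXd,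
    leviCivita_metric I hXd hXd hξ]
  rw [real_inner_comm (leviCivita I X x (X x))]
  linear_combination (β x - μ) * inner ℝ (X x) (s.xi x) * hsym

/-- If the Ricci tensor is cyclic parallel, then `β` is locally constant and `β (β - μ) = 0`. -/
theorem IsEtaEinsteinSoliton.beta_of_cyclicParallel {lam μ : ℝ}
    (hsol : IsEtaEinsteinSoliton I s lam μ) (hs : IsTransSasakian I s α β)
    (hE : Module.finrank ℝ E = 3) (hS : HasCyclicParallelRicci I M) (x : M) :
    d% β x = 0 ∧ (β x - μ) * β x = 0 := by
  have key : ∀ v : TangentSpace I x, d% β x v * (inner ℝ v v + s.eta x v ^ 2)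
      + 2 * (β x - μ) * β x * s.eta x v * (inner ℝ v v - s.eta x v ^ 2) = 0 := by
    intro v
    have hv := smoothFieldAt_extend (I := I) v
    have h := hS.2 x _ _ _ hv hv hv
    rw [hsol.covDerivRicci_self hs hE hv] at h
    simp only [extend_apply_self] at h
    linarith
  have hperp : ∀ v : TangentSpace I x, s.eta x v = 0 → d% β x v = 0 := by
    intro v hv
    have h := key v
    rw [hv] at h
    rcases eq_or_ne v 0 with rfl | hv0
    · simp
    · have : (inner ℝ v v : ℝ) ≠ 0 := inner_self_ne_zero.2 hv0
      simpa [hv0] using h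
  have hξ : d% β x (s.xi x) = 0 := by
    have h := key (s.xi x)
    rw [s.eta_xi, s.inner_xi_xi] at h
    linarith
  have hd : d% β x = 0 := by
    ext v
    have h := hperp (v - s.eta x v • s.xi x) (by simp [s.eta_xi])
    rw [map_sub, map_smul, hξ] at h
    simpa using h
  refine ⟨hd, ?_⟩
  obtain ⟨u, hu, hu0⟩ := s.exists_unit_orthogonal (by omega) x
  -- The second term of `key` vanishes on $\xi^\perp$ and at $\xi$, so a mixed vector is needed:
  -- $\eta(u+\xi)=1$ and $|u+\xi|^2=2$ make it $2(\beta-\mu)\beta$.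
  have h := key (u + s.xi x)
  rw [hd, map_add (s.eta x), hu0, s.eta_xi, inner_add_left, inner_add_right, inner_add_right,
    real_inner_comm u (s.xi x), ← s.eta_eq_inner, hu0, hu, s.inner_xi_xi, zero_apply] at h
  linarith

/-! ### Curvature in the direction of $\xi$ when $\beta=0$ -/

/-- `R(X, Y) ξ` for an `α`-Sasakian structure. -/
theorem IsAlphaSasakian.curvature_xi (hs : IsAlphaSasakian I s α)
    {X Y : Π x : M, TangentSpace I x} {x : M} (hX : SmoothFieldAt I X x)
    (hY : SmoothFieldAt I Y x) :
    curvature I X Y s.xi x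
      = d% α x (Y x) • s.phi x (X x) - d% α x (X x) • s.phi x (Y x)
        + α x ^ 2 • (s.eta x (Y x) • X x - s.eta x (X x) • Y x) := by
  have hα : ContMDiffAt I 𝓘(ℝ, ℝ) ∞ α x := hs.smooth_alpha x
  have hnabla : ∀ (y : M) (v : TangentSpace I y),
      leviCivita I s.xi y v = -α y • s.phi y v := fun y v ↦ by
    rw [IsTransSasakian.leviCivita_xi hs]
    simp
  have hsecond : ∀ {A B : Π x : M, TangentSpace I x}, SmoothFieldAt I A x → SmoothFieldAt I B x →
      leviCivita I (fun y ↦ leviCivita I s.xi y (B y)) x (A x)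
        = -α x • (s.phi x (leviCivita I B x (A x)) +
            α x • ((inner ℝ (A x) (B x) : ℝ) • s.xi x - s.eta x (B x) • A x))
          - d% α x (A x) • s.phi x (B x) := by
    intro A B hA hB
    have hφ := hs.covDeriv_phi x A B hA hB
    rw [covDerivEndo, sub_eq_iff_eq_add'] at hφ
    have hα' : MDiffAt (-α) x := hα.neg.mdifferentiableAt (by simp)
    have e : (fun y ↦ leviCivita I s.xi y (B y))
        = ((-α) • (fun y ↦ s.phi y (B y)) : Π y : M, TangentSpace I y) :=
      funext fun y ↦ hnabla y (B y)
    rw [e, (leviCivita I).isCovariantDerivativeOn.leibniz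
      (s.smoothFieldAt_phi hB).mdifferentiableAt hα']
    simp only [add_apply, smul_apply, ContinuousLinearMap.smulRight_apply, mvfderiv_neg,
      neg_apply, Pi.neg_apply, hφ, Pi.zero_apply, zero_smul, add_zero, neg_smul]
    abel
  -- By torsion-freeness the terms $\alpha\phi(\nabla_XY-\nabla_YX)$ cancel against
  -- $\nabla_{[X,Y]}\xi$.
  rw [curvature, hsecond hX hY, hsecond hY hX, hnabla,
    ← leviCivita_torsion_free I hX.mdifferentiableAt hY.mdifferentiableAt,
    real_inner_comm (X x) (Y x), map_sub]
  module

/-- `S(ξ, ξ) = (n - 1) α²` for an `α`-Sasakian structure in dimension `n`. -/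
theorem IsAlphaSasakian.ricci_xi_xi (hs : IsAlphaSasakian I s α) (x : M) :
    ricci I x (s.xi x) (s.xi x) = (Module.finrank ℝ E - 1) * α x ^ 2 := by
  have hterm : ∀ v : TangentSpace I x, (inner ℝ
      (curvature I (extend E v) (extend E (s.xi x)) (extend E (s.xi x)) x) v : ℝ)
        = α x ^ 2 * (inner ℝ v v - s.eta x v * s.eta x v) := by
    intro v
    have hv := smoothFieldAt_extend (I := I) v
    have hξ := smoothFieldAt_extend (I := I) (s.xi x)
    -- `ricci` uses an arbitrary extension of $\xi_x$ in the third slot, `curvature_xi` the field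
    -- $\xi$. Skew-symmetry turns both into the same expression, which sees that slot only through
    -- its value at $x$.
    have h1 := inner_curvature_skew hv hξ hξ hv
    have h2 := inner_curvature_skew hv hξ (s.smooth_xi x) hv
    simp only [extend_apply_self] at h1 h2
    rw [h1, ← h2, hs.curvature_xi hv hξ]
    simp only [extend_apply_self, s.phi_xi, smul_zero, sub_zero, s.eta_xi, one_smul,
      inner_add_left, inner_sub_left, real_inner_smul_left, s.inner_phi_self]
    rw [real_inner_comm v (s.xi x), ← s.eta_eq_inner]
    ring
  rw [ricci]
  simp only [hterm]
  rw [← Finset.mul_sum, Finset.sum_sub_distrib, sum_inner_tangentBasis, s.sum_eta_sq]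
  ring

end RiemannianGeometry

/-! ### Conclusion -/

open RiemannianGeometry in
theorem theorem4p4 {M : Type*} [TopologicalSpace M] [ChartedSpace (EuclideanSpace ℝ (Fin 3)) M]
    [IsManifold (𝓡 3) ∞ M]
    [RiemannianBundle (fun x : M ↦ TangentSpace (𝓡 3) x)]
    [IsContMDiffRiemannianBundle (𝓡 3) ∞ (EuclideanSpace ℝ (Fin 3))
      (fun x : M ↦ TangentSpace (𝓡 3) x)]
    (s : AlmostContactMetricStructure (𝓡 3) M) (α β : M → ℝ) (lam μ : ℝ)
    (hs : IsTransSasakian (𝓡 3) s α β)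
    (hsol : IsEtaEinsteinSoliton (𝓡 3) s lam μ)
    (hS : HasCyclicParallelRicci (𝓡 3) M)
    (hμ : ∀ x : M, ∃ y ∈ connectedComponent x, μ ≠ β y) :
    (∀ x, β x = 0) ∧ IsAlphaSasakian (𝓡 3) s α ∧ (∀ x, lam = α x ^ 2) ∧
      ((∃ x, α x ≠ 0) → IsExpanding lam) := by
  have hE : Module.finrank ℝ (EuclideanSpace ℝ (Fin 3)) = 3 := by simp
  have hβ := hsol.beta_of_cyclicParallel hs hE hS
  have hconst : IsLocallyConstant β := isLocallyConstant_of_mvfderiv_eq_zero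
    (I := 𝓡 3) (hs.smooth_beta.mdifferentiable (by simp)) fun x ↦ (hβ x).1
  have hzero : ∀ x, β x = 0 := by
    intro x
    obtain ⟨y, hy, hne⟩ := hμ x
    -- Move to the point $y$ of the component where $\beta\ne\mu$; there $\beta(\beta-\mu)=0$ forces
    -- $\beta=0$.
    rw [hconst.apply_eq_of_isPreconnected isPreconnected_connectedComponent
      mem_connectedComponent hy]
    exact (mul_eq_zero.1 (hβ y).2).resolve_left (sub_ne_zero.2 hne.symm)
  have hα : IsAlphaSasakian (𝓡 3) s α := by
    have h0 : β = 0 := funext hzero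
    rwa [h0] at hs
  have hlam : ∀ x, lam = α x ^ 2 := by
    intro x
    -- At $(\xi,\xi)$ the two occurrences of $\mu$ cancel, leaving $2\alpha^2=2\lambda$.
    have h := hsol.ricci_eq hs hE x (s.xi x) (s.xi x)
    rw [hα.ricci_xi_xi, hE, hzero, s.eta_xi, s.inner_xi_xi] at h
    push_cast at h
    linarith
  exact ⟨hzero, hα, hlam, fun ⟨x, hx⟩ ↦ by
    rw [IsExpanding, hlam x]
    positivity⟩
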